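/- Let $A \in \mathbb{R}^{m \times n}$ and $b \in \mathbb{R}^m$ be such that the polyhedron $\mathcal{P} = \{x \in \mathbb{R}^n : Ax \geq b\}$ is a polytope, i.e., the convex hull of a (possibly empty) finite set of points. Let $\widetilde{b} = [\, b \;\; -\mathrm{Id}_m \,] \in \mathbb{R}^{m \times (1+m)}$. For a matrix $M$ with $m$ rows and $I \subset \{1,\dots,m\}$, let $M_I$ be the submatrix of the rows of $M$ with index in $I$. A set $I \subset \{1,\dots,m\}$ is called a lex-feasible basis if $\# I = n$, the matrix $A_I$ is nonsingular, and the matrix $X^I = A_I^{-1}\,\widetilde{b}_I \in \mathbb{R}^{n \times (1+m)}$ is such that, for every $i \in \{1,\dots,m\}$, the $i$th row of $A X^I$ is greater than or equal to the $i$th row of $\widetilde{b}$ in the lexicographic order on $\mathbb{R}^{1+m}$. Let $G_{\mathrm{lex}}$ be the graph whose vertices are the lex-feasible bases, two of them, $I$ and $J$, being adjacent if $\#(I \cap J) = n-1$. Then: (1) $G_{\mathrm{lex}}$ is connected: any two lex-feasible bases are joined by a path in $G_{\mathrm{lex}}$; moreover, if $\mathcal{P} \neq \emptyset$, then $G_{\mathrm{lex}}$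 has at least one vertex. (2) $G_{\mathrm{lex}}$ is $n$-regular: every lex-feasible basis is adjacent to exactly $n$ lex-feasible bases. -/

import Mathlib

noncomputable section

/-- The polyhedron `{x ∈ ℝⁿ : A x ≥ b}`, with the entrywise order on `ℝᵐ`. -/
def polyhedron {m n : ℕ} (A : Matrix (Fin m) (Fin n) ℝ) (b : Fin m → ℝ) : Set (Fin n → ℝ) :=
  {x | ∀ i, b i ≤ A.mulVec x i}

/-- A polytope is the convex hull of finitely many points. -/
def IsPolytope {n : ℕ} (P : Set (Fin n → ℝ)) : Prop :=
  ∃ V : Finset (Fin n → ℝ), P = convexHull ℝ (V : Set (Fin n → ℝ))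

/-- The perturbed right-hand side `[b  -Id]`: row `i` is `(b i, 0, …, 0, -1, 0, …, 0)` and
encodes the polynomial `b i - ε ^ i` (with `i` counted from `1`). -/
def bPert {m : ℕ} (b : Fin m → ℝ) : Matrix (Fin m) (Fin (m + 1)) ℝ :=
  Matrix.of fun i => (Fin.cons (b i) ((-(1 : Matrix (Fin m) (Fin m) ℝ)) i) : Fin (m + 1) → ℝ)

/-- `rowsOf M I h` is the submatrix `M_I` of the rows of `M` with index in the `n`-element set `I`,
in increasing order of the index. -/
def rowsOf {m n : ℕ} {κ : Type*} (M : Matrix (Fin m) κ ℝ) (I : Finset (Fin m))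
    (h : I.card = n) : Matrix (Fin n) κ ℝ :=
  M.submatrix (I.orderEmbOfFin h) id

/-- Entrywise lexicographic order on matrices: every row of `X` is at most the row of `Y` with the
same index, for the lexicographic order on tuples. -/
def LexLE {p q : ℕ} (X Y : Matrix (Fin p) (Fin q) ℝ) : Prop :=
  ∀ i, toLex (X i) ≤ toLex (Y i)

/-- The perturbed basic point `X^I = A_I⁻¹ b̃_I`, meaningful when `A_I` is nonsingular. -/
def lexBasicPoint {m n : ℕ} (A : Matrix (Fin m) (Fin n) ℝ) (b : Fin m → ℝ)
    (I : Finset (Fin m)) (h : I.card = n) : Matrix (Fin n) (Fin (m + 1)) ℝ :=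
  (rowsOf A I h)⁻¹ * rowsOf (bPert b) I h

/-- `I` is a lex-feasible basis: it has `n` elements, `A_I` is nonsingular, and
`A X^I ≥_lex b̃`. -/
def IsLexFeasibleBasis {m n : ℕ} (A : Matrix (Fin m) (Fin n) ℝ) (b : Fin m → ℝ)
    (I : Finset (Fin m)) : Prop :=
  ∃ h : I.card = n, IsUnit (rowsOf A I h).det ∧ LexLE (bPert b) (A * lexBasicPoint A b I h)

/-- The graph of lex-feasible bases: `I` and `J` are adjacent when `#(I ∩ J) = n - 1`
(subtraction of integers, so that there is no adjacent pair when `n = 0`). -/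
def lexGraph {m n : ℕ} (A : Matrix (Fin m) (Fin n) ℝ) (b : Fin m → ℝ) :
    SimpleGraph {I : Finset (Fin m) // IsLexFeasibleBasis A b I} where
  Adj I J := (I.1 ∩ J.1).card + 1 = n
  symm := ⟨fun I J h => by rw [Finset.inter_comm]; exact h⟩
  loopless := ⟨fun I h => by
    obtain ⟨hc, -⟩ := I.2
    rw [Finset.inter_self] at h
    omega⟩

end

/-!
The formal variable `ε` of the perturbation is replaced by a small positive real number. A row
`v` of one of the finitely many matrices `A * X^I - b̃` is lexicographically positive exactly when
`∑ k, v k * ε ^ k` is positive for all small `ε > 0` (`eventually_lex_lt_dotProduct`). So for a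
suitable `ε` the lex-feasible bases are the feasible bases of the honest system `A x ≥ c`, where
`c i = b i - ε ^ (i + 1)` (`isLexFeasibleBasis_iff`). The `i`th perturbation column makes this
system nondegenerate: at a basic point only the constraints of the basis are tight.

For a nondegenerate system whose recession cone is trivial, the claim is the usual argument of the
simplex method. Leaving a feasible basis `I` by dropping `j ∈ I` means moving along the ray on which
the other constraints of `I` stay tight; this ray leaves the polyhedron, and the ratio test gives
the entering index (`IsFeasibleBasis.pivot`), which is unique by nondegeneracy
(`IsFeasibleBasis.eq_of_erase_subset`). Hence the neighbours of `I` correspond to the elements of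
`I`. For connectedness, the linear form `∑ i ∈ K, (A x) i` is minimized on the polyhedron only at
the basic point of `K`, and every other feasible basis has a neighbour with a smaller value
(`IsFeasibleBasis.exists_descent`). A feasible point with a maximal set of tight constraints yields
a feasible basis (`exists_isFeasibleBasis`).
-/

open Matrix Filter Topology

/-! ### Feasible bases of a system of linear inequalities -/

section Simplex

variable {ι κ : Type*} [Fintype κ]

/-- The rows of `A` with index in `I` have no common kernel: a vector is determined by the values
of these rows. -/
def RowsSeparate (A : Matrix ι κ ℝ) (I : Finset ι) : Prop :=
  ∀ v : κ → ℝ, (∀ i ∈ I, (A *ᵥ v) i = 0) → v = 0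

/-- `I` is a basis of the system `A x ≥ c` with basic point `x`, which is feasible and tight at the
constraints of `I` only. -/
structure IsFeasibleBasis (A : Matrix ι κ ℝ) (c : ι → ℝ) (I : Finset ι) (x : κ → ℝ) : Prop where
  card_eq : I.card = Fintype.card κ
  separate : RowsSeparate A I
  tight : ∀ i ∈ I, (A *ᵥ x) i = c i
  slack : ∀ i ∉ I, c i < (A *ᵥ x) i

/-- No basic point of the system `A x ≥ c`, feasible or not, is tight at a constraint outside its
basis. -/
def IsNondegenerate (A : Matrix ι κ ℝ) (c : ι → ℝ) : Prop :=
  ∀ (I : Finset ι) (x : κ → ℝ), I.card = Fintype.card κ → RowsSeparate A I →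
    (∀ i ∈ I, (A *ᵥ x) i = c i) → ∀ i ∉ I, (A *ᵥ x) i ≠ c i

/-- The recession cone `{v | A v ≥ 0}` is trivial. -/
def HasTrivialRecession (A : Matrix ι κ ℝ) : Prop :=
  ∀ v : κ → ℝ, (∀ i, 0 ≤ (A *ᵥ v) i) → v = 0

variable {A : Matrix ι κ ℝ} {c : ι → ℝ} {I J K : Finset ι} {x y z d : κ → ℝ}

lemma mulVec_add_smul_apply (A : Matrix ι κ ℝ) (x d : κ → ℝ) (t : ℝ) (i : ι) :
    (A *ᵥ (x + t • d)) i = (A *ᵥ x) i + t * (A *ᵥ d) i := by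
  simp [Matrix.mulVec_add, Matrix.mulVec_smul]

lemma RowsSeparate.eq (h : RowsSeparate A I) (hxy : ∀ i ∈ I, (A *ᵥ x) i = (A *ᵥ y) i) :
    x = y := by
  refine sub_eq_zero.1 (h _ fun i hi => ?_)
  simp [Matrix.mulVec_sub, hxy i hi]

lemma RowsSeparate.exists_mulVec_eq (h : RowsSeparate A I) (hcard : I.card = Fintype.card κ)
    (u : ι → ℝ) : ∃ v : κ → ℝ, ∀ i ∈ I, (A *ᵥ v) i = u i := by
  let L : (κ → ℝ) →ₗ[ℝ] (I → ℝ) :=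
    (LinearMap.funLeft ℝ ℝ (Subtype.val : I → ι)).comp A.mulVecLin
  have hinj : Function.Injective L := by
    refine (injective_iff_map_eq_zero L).2 fun v hv => h v fun i hi => ?_
    exact congrFun hv ⟨i, hi⟩
  have hsurj : Function.Surjective L :=
    (LinearMap.injective_iff_surjective_of_finrank_eq_finrank (by simp [hcard])).1 hinj
  obtain ⟨v, hv⟩ := hsurj fun i => u i
  exact ⟨v, fun i hi => congrFun hv ⟨i, hi⟩⟩

namespace IsFeasibleBasis

lemma feasible (h : IsFeasibleBasis A c I x) (i : ι) : c i ≤ (A *ᵥ x) i := by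
  by_cases hi : i ∈ I
  · exact (h.tight i hi).ge
  · exact (h.slack i hi).le

lemma mem_iff (h : IsFeasibleBasis A c I x) (i : ι) : i ∈ I ↔ (A *ᵥ x) i = c i :=
  ⟨h.tight i, fun hi => by_contra fun hn => (h.slack i hn).ne' hi⟩

lemma point_unique (h : IsFeasibleBasis A c I x) (h' : IsFeasibleBasis A c I y) : x = y :=
  h.separate.eq fun i hi => by rw [h.tight i hi, h'.tight i hi]

end IsFeasibleBasis

/-- Ratio test: the last feasible point of a ray along which some constraint decreases. -/
lemma exists_ratio_test [Finite ι] (hx : ∀ i, c i ≤ (A *ᵥ x) i) (hd : ∃ i, (A *ᵥ d) i < 0) :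
    ∃ t : ℝ, 0 ≤ t ∧ (∀ i, c i ≤ (A *ᵥ (x + t • d)) i) ∧
      ∃ k, (A *ᵥ d) k < 0 ∧ (A *ᵥ (x + t • d)) k = c k := by
  obtain ⟨k, hk, hmin⟩ := Set.exists_min_image {i | (A *ᵥ d) i < 0}
    (fun i => ((A *ᵥ x) i - c i) / -(A *ᵥ d) i) (Set.toFinite _) hd
  change (A *ᵥ d) k < 0 at hk
  change ∀ i, (A *ᵥ d) i < 0 → _ at hmin
  have ht : 0 ≤ ((A *ᵥ x) k - c k) / -(A *ᵥ d) k :=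
    div_nonneg (sub_nonneg.2 (hx k)) (neg_nonneg.2 hk.le)
  refine ⟨_, ht, fun i => ?_, k, hk, ?_⟩
  · rw [mulVec_add_smul_apply]
    rcases lt_or_ge ((A *ᵥ d) i) 0 with hi | hi
    · have := (le_div_iff₀ (neg_pos.2 hi)).1 (hmin i hi)
      linarith
    · linarith [hx i, mul_nonneg ht hi]
  · rw [mulVec_add_smul_apply]
    field_simp [hk.ne]
    ring

variable [DecidableEq ι]

/-- The direction of the edge on which the constraint `j` of the basis is released. -/
lemma IsFeasibleBasis.exists_edge (h : IsFeasibleBasis A c I x) {j : ι} (hj : j ∈ I) :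
    ∃ d : κ → ℝ, (∀ i ∈ I.erase j, (A *ᵥ d) i = 0) ∧ (A *ᵥ d) j = 1 := by
  obtain ⟨d, hd⟩ := h.separate.exists_mulVec_eq h.card_eq (Pi.single j 1)
  refine ⟨d, fun i hi => ?_, by simpa using hd j hj⟩
  rw [hd i (Finset.mem_of_mem_erase hi), Pi.single_eq_of_ne (Finset.ne_of_mem_erase hi)]

/-- If the basis of `y` arises from `I` by replacing `j`, no basic feasible point `z` lies beyond
`y` on the edge at `x` that releases `j`: the constraint of `J` that is slack at `x` is tight at
`y` and would be violated further along the edge. -/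
lemma IsFeasibleBasis.not_lt_of_erase_subset (h : IsFeasibleBasis A c I x)
    (hJ : IsFeasibleBasis A c J y)
    (hK : IsFeasibleBasis A c K z) {j : ι} (hj : j ∈ I) (hIJ : I.erase j ⊆ J) (hjJ : j ∉ J)
    (hIK : I.erase j ⊆ K) : ¬ (A *ᵥ y) j < (A *ᵥ z) j := by
  intro hlt
  obtain ⟨d, hd0, hd1⟩ := h.exists_edge hj
  have key : ∀ {L : Finset ι} {w : κ → ℝ}, IsFeasibleBasis A c L w → I.erase j ⊆ L →
      w = x + ((A *ᵥ w) j - c j) • d := by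
    intro L w hL hIL
    refine h.separate.eq fun i hi => ?_
    rw [mulVec_add_smul_apply]
    by_cases hij : i = j
    · rw [hij, hd1, h.tight j hj]
      ring
    · have hi' := Finset.mem_erase.2 ⟨hij, hi⟩
      rw [hd0 i hi', h.tight i hi, hL.tight i (hIL hi')]
      ring
  have hslack := hJ.slack j hjJ
  obtain ⟨k, hkJ, hkI⟩ : ∃ k ∈ J, k ∉ I := by
    by_contra! hsub
    rw [Finset.eq_of_subset_of_card_le hsub (h.card_eq.trans hJ.card_eq.symm).le] at hjJ
    exact hjJ hj
  have hky := hJ.tight k hkJ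
  have hkz := hK.feasible k
  have hkx := h.slack k hkI
  rw [key hJ hIJ, mulVec_add_smul_apply] at hky
  rw [key hK hIK, mulVec_add_smul_apply] at hkz
  have hneg : (A *ᵥ d) k < 0 := by
    by_contra! hn
    have := mul_nonneg (sub_nonneg.2 hslack.le) hn
    linarith
  have := mul_lt_mul_of_neg_right (sub_lt_sub_right hlt (c j)) hneg
  linarith

lemma IsFeasibleBasis.eq_of_erase_subset (h : IsFeasibleBasis A c I x)
    (hJ : IsFeasibleBasis A c J y)
    (hK : IsFeasibleBasis A c K z) {j : ι} (hj : j ∈ I) (hIJ : I.erase j ⊆ J) (hjJ : j ∉ J)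
    (hIK : I.erase j ⊆ K) (hjK : j ∉ K) : J = K := by
  have hyz : y = z := h.separate.eq fun i hi => by
    by_cases hij : i = j
    · rw [hij]
      exact le_antisymm (not_lt.1 (h.not_lt_of_erase_subset hK hJ hj hIK hjK hIJ))
        (not_lt.1 (h.not_lt_of_erase_subset hJ hK hj hIJ hjJ hIK))
    · have hi' := Finset.mem_erase.2 ⟨hij, hi⟩
      rw [hJ.tight i (hIJ hi'), hK.tight i (hIK hi')]
  subst hyz
  ext i
  rw [hJ.mem_iff, hK.mem_iff]

lemma card_inter_insert_erase {j k : ι} (hj : j ∈ I) (hk : k ∉ I) :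
    (I ∩ insert k (I.erase j)).card + 1 = I.card := by
  rw [Finset.inter_insert_of_notMem hk, Finset.inter_eq_right.2 (Finset.erase_subset j I),
    Finset.card_erase_add_one hj]

variable [Finite ι]

/-- A minimal separating set of rows is a basis: minimality provides the coordinate
vectors in the image of the restricted matrix. -/
lemma RowsSeparate.exists_subset_card_eq (h : RowsSeparate A I) :
    ∃ J ⊆ I, J.card = Fintype.card κ ∧ RowsSeparate A J := by
  obtain ⟨J, hJI, hJ⟩ :=
    (Set.toFinite {J : Finset ι | RowsSeparate A J}).exists_le_minimal (a := I) h
  refine ⟨J, hJI, ?_, hJ.prop⟩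
  have hdir : ∀ j ∈ J, ∃ v : κ → ℝ, (∀ i ∈ J.erase j, (A *ᵥ v) i = 0) ∧ (A *ᵥ v) j = 1 := by
    intro j hj
    have hnot : ¬ RowsSeparate A (J.erase j) := fun hs =>
      Finset.notMem_erase j J (hJ.le_of_le hs (Finset.erase_subset j J) hj)
    simp only [RowsSeparate, not_forall] at hnot
    obtain ⟨v, hv, hv0⟩ := hnot
    have hvj : (A *ᵥ v) j ≠ 0 := fun h0 => hv0 <| hJ.prop v fun i hi => by
      by_cases hij : i = j
      · rw [hij, h0]
      · exact hv i (Finset.mem_erase.2 ⟨hij, hi⟩)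
    refine ⟨((A *ᵥ v) j)⁻¹ • v, fun i hi => ?_, ?_⟩
    · simp [Matrix.mulVec_smul, hv i hi]
    · simp [Matrix.mulVec_smul, hvj]
  choose! d hd0 hd1 using hdir
  let L : (κ → ℝ) →ₗ[ℝ] (J → ℝ) :=
    (LinearMap.funLeft ℝ ℝ (Subtype.val : J → ι)).comp A.mulVecLin
  have hinj : Function.Injective L := by
    refine (injective_iff_map_eq_zero L).2 fun v hv => hJ.prop v fun i hi => ?_
    exact congrFun hv ⟨i, hi⟩
  have hsurj : Function.Surjective L := by
    intro u
    refine ⟨∑ j : J, u j • d j, ?_⟩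
    have hL : ∀ j : J, L (d j) = Pi.single j 1 := by
      intro j
      ext i
      by_cases hij : i = j
      · subst hij
        simpa [L] using hd1 i i.2
      · rw [Pi.single_eq_of_ne hij]
        exact hd0 j j.2 i (Finset.mem_erase.2 ⟨fun h => hij (Subtype.ext h), i.2⟩)
    ext i
    simp [hL, Finset.sum_apply, Pi.single_apply]
  simpa using (LinearEquiv.ofBijective L ⟨hinj, hsurj⟩).finrank_eq.symm

namespace IsFeasibleBasis

/-- The pivot step: the edge that leaves the basic point by releasing `j` ends at a basic point
whose basis replaces `j` by another index. -/
lemma pivot (h : IsFeasibleBasis A c I x) (hrec : HasTrivialRecession A)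
    (hnd : IsNondegenerate A c) {j : ι} (hj : j ∈ I)
    (hd0 : ∀ i ∈ I.erase j, (A *ᵥ d) i = 0) (hd1 : (A *ᵥ d) j = 1) :
    ∃ k ∉ I, ∃ t : ℝ, 0 < t ∧ IsFeasibleBasis A c (insert k (I.erase j)) (x + t • d) := by
  have hneg : ∃ i, (A *ᵥ d) i < 0 := by
    by_contra! hn
    have hzero := hrec d hn
    simp [hzero] at hd1
  obtain ⟨t, ht, hfeas, k, hk, htight⟩ := exists_ratio_test h.feasible hneg
  have hkI : k ∉ I := by
    intro hkI
    by_cases hkj : k = j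
    · rw [hkj, hd1] at hk
      linarith
    · exact hk.ne (hd0 k (Finset.mem_erase.2 ⟨hkj, hkI⟩))
  have hk' : k ∉ I.erase j := fun hm => hkI (Finset.mem_of_mem_erase hm)
  have htpos : 0 < t := by
    refine ht.lt_of_ne fun h0 => ?_
    rw [← h0, zero_smul, add_zero] at htight
    exact (h.slack k hkI).ne' htight
  have hcard : (insert k (I.erase j)).card = Fintype.card κ := by
    rw [Finset.card_insert_of_notMem hk', Finset.card_erase_add_one hj, h.card_eq]
  have hsep : RowsSeparate A (insert k (I.erase j)) := by
    intro v hv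
    -- On `I` the vector `v` agrees with a multiple of `d`, and the `k`th row kills the factor.
    have hvd : v = (A *ᵥ v) j • d := h.separate.eq fun i hi => by
      by_cases hij : i = j
      · simp [hij, Matrix.mulVec_smul, hd1]
      · have hi' := Finset.mem_erase.2 ⟨hij, hi⟩
        simp [Matrix.mulVec_smul, hd0 i hi', hv i (Finset.mem_insert_of_mem hi')]
    have hvk := hv k (Finset.mem_insert_self _ _)
    rw [hvd, Matrix.mulVec_smul, Pi.smul_apply, smul_eq_mul] at hvk
    rw [hvd, (mul_eq_zero.1 hvk).resolve_right hk.ne, zero_smul]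
  have htight' : ∀ i ∈ insert k (I.erase j), (A *ᵥ (x + t • d)) i = c i := by
    intro i hi
    rcases Finset.mem_insert.1 hi with rfl | hi
    · exact htight
    · rw [mulVec_add_smul_apply, hd0 i hi, mul_zero, add_zero,
        h.tight i (Finset.mem_of_mem_erase hi)]
  exact ⟨k, hkI, t, htpos, hcard, hsep, htight',
    fun i hi => (hfeas i).lt_of_ne' (hnd _ _ hcard hsep htight' i hi)⟩

/-- Unless `I = K`, a pivot step from `I` decreases the linear form `∑ i ∈ K, (A x) i`. Otherwise
all edges at `x` would increase it, and so would the step to the basic point of `K`, its unique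
minimizer. -/
lemma exists_descent (h : IsFeasibleBasis A c I x) (hK : IsFeasibleBasis A c K z)
    (hrec : HasTrivialRecession A) (hnd : IsNondegenerate A c) (hne : I ≠ K) :
    ∃ j ∈ I, ∃ k ∉ I, ∃ y, IsFeasibleBasis A c (insert k (I.erase j)) y ∧
      ∑ i ∈ K, (A *ᵥ y) i < ∑ i ∈ K, (A *ᵥ x) i := by
  have hlt : ∑ i ∈ K, (A *ᵥ z) i < ∑ i ∈ K, (A *ᵥ x) i := by
    obtain ⟨k, hkK, hkI⟩ : ∃ k ∈ K, k ∉ I := by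
      by_contra! hsub
      exact hne (Finset.eq_of_subset_of_card_le hsub (h.card_eq.trans hK.card_eq.symm).le).symm
    exact Finset.sum_lt_sum (fun i hi => by rw [hK.tight i hi]; exact h.feasible i)
      ⟨k, hkK, by rw [hK.tight k hkK]; exact h.slack k hkI⟩
  have hedge := fun j (hj : j ∈ I) => h.exists_edge hj
  choose! d hd0 hd1 using hedge
  obtain ⟨j, hj, hneg⟩ : ∃ j ∈ I, ∑ i ∈ K, (A *ᵥ d j) i < 0 := by
    by_contra! hn
    have hz : z = x + ∑ j ∈ I, ((A *ᵥ z) j - c j) • d j := h.separate.eq fun i hi => by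
      rw [Matrix.mulVec_add, Pi.add_apply, Matrix.mulVec_sum, Finset.sum_apply,
        Finset.sum_eq_single_of_mem i hi, h.tight i hi]
      · simp [Matrix.mulVec_smul, hd1 i hi]
      · intro l hl hli
        simp [Matrix.mulVec_smul, hd0 l hl i (Finset.mem_erase.2 ⟨hli.symm, hi⟩)]
    have hsum : ∑ i ∈ K, (A *ᵥ z) i =
        ∑ i ∈ K, (A *ᵥ x) i + ∑ j ∈ I, ((A *ᵥ z) j - c j) * ∑ i ∈ K, (A *ᵥ d j) i := by
      conv_lhs => rw [hz]
      simp only [Matrix.mulVec_add, Matrix.mulVec_sum, Matrix.mulVec_smul, Pi.add_apply,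
        Finset.sum_apply, Pi.smul_apply, smul_eq_mul, Finset.sum_add_distrib, Finset.mul_sum]
      rw [Finset.sum_comm]
    have hnonneg : 0 ≤ ∑ j ∈ I, ((A *ᵥ z) j - c j) * ∑ i ∈ K, (A *ᵥ d j) i :=
      Finset.sum_nonneg fun j hj => mul_nonneg (sub_nonneg.2 (hK.feasible j)) (hn j hj)
    linarith
  obtain ⟨k, hk, t, ht, hb⟩ := h.pivot hrec hnd hj (hd0 j hj) (hd1 j hj)
  refine ⟨j, hj, k, hk, _, hb, ?_⟩
  simp only [mulVec_add_smul_apply, Finset.sum_add_distrib, ← Finset.mul_sum]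
  linarith [mul_neg_of_pos_of_neg ht hneg]

end IsFeasibleBasis

/-- A feasible point with a maximal set of tight constraints is a vertex, since otherwise it could
be moved inside the tight constraints until another one becomes tight. -/
lemma exists_isFeasibleBasis (hrec : HasTrivialRecession A) (hnd : IsNondegenerate A c)
    (hx : ∀ i, c i ≤ (A *ᵥ x) i) : ∃ I y, IsFeasibleBasis A c I y := by
  obtain ⟨T, hT⟩ := (Set.toFinite {T : Finset ι | ∃ y : κ → ℝ, (∀ i, c i ≤ (A *ᵥ y) i) ∧
    ∀ i ∈ T, (A *ᵥ y) i = c i}).exists_maximal ⟨∅, x, hx, by simp⟩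
  obtain ⟨y, hy, hyT⟩ := hT.prop
  have hsep : RowsSeparate A T := by
    intro v hv
    by_contra hv0
    have hneg : ∃ i, (A *ᵥ v) i < 0 := by
      by_contra! hn
      exact hv0 (hrec v hn)
    obtain ⟨t, -, hfeas, k, hk, htight⟩ := exists_ratio_test hy hneg
    have hmem : k ∈ T := by
      refine hT.le_of_ge ⟨_, hfeas, fun i hi => ?_⟩ (Finset.subset_insert k T)
        (Finset.mem_insert_self k T)
      rcases Finset.mem_insert.1 hi with rfl | hi
      · exact htight
      · rw [mulVec_add_smul_apply, hv i hi, hyT i hi, mul_zero, add_zero]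
    exact hk.ne (hv k hmem)
  obtain ⟨I, hIT, hcard, hI⟩ := hsep.exists_subset_card_eq
  have hyI : ∀ i ∈ I, (A *ᵥ y) i = c i := fun i hi => hyT i (hIT hi)
  exact ⟨I, y, hcard, hI, hyI, fun i hi => (hy i).lt_of_ne' (hnd I y hcard hI hyI i hi)⟩

/-! ### The graph of feasible bases -/

/-- The graph of feasible bases of `A x ≥ c`: two of them are adjacent when they differ by the
exchange of one index. -/
def feasibleBasisGraph (A : Matrix ι κ ℝ) (c : ι → ℝ) :
    SimpleGraph {I : Finset ι // ∃ x, IsFeasibleBasis A c I x} where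
  Adj I J := (I.1 ∩ J.1).card + 1 = Fintype.card κ
  symm := ⟨fun I J h => by rw [Finset.inter_comm]; exact h⟩
  loopless := ⟨fun I h => by
    obtain ⟨x, hx⟩ := I.2
    rw [Finset.inter_self, hx.card_eq] at h
    omega⟩

lemma feasibleBasisGraph_preconnected (hrec : HasTrivialRecession A)
    (hnd : IsNondegenerate A c) : (feasibleBasisGraph A c).Preconnected := by
  intro I₀ K
  by_contra hI₀
  choose p hp using fun I : {I : Finset ι // ∃ x, IsFeasibleBasis A c I x} => I.2
  obtain ⟨I, hI, hmin⟩ := Set.exists_min_image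
    {I | ¬ (feasibleBasisGraph A c).Reachable I K} (fun I => ∑ i ∈ K.1, (A *ᵥ p I) i)
    (Set.toFinite _) ⟨I₀, hI₀⟩
  have hne : I.1 ≠ K.1 := fun h => hI (Subtype.ext h ▸ SimpleGraph.Reachable.refl _)
  obtain ⟨j, hj, k, hk, y, hy, hlt⟩ := (hp I).exists_descent (hp K) hrec hnd hne
  let J : {I : Finset ι // ∃ x, IsFeasibleBasis A c I x} := ⟨insert k (I.1.erase j), y, hy⟩
  have hadj : (feasibleBasisGraph A c).Adj I J :=
    (card_inter_insert_erase hj hk).trans (hp I).card_eq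
  have hJ : ¬ (feasibleBasisGraph A c).Reachable J K := fun hJ => hI (hadj.reachable.trans hJ)
  have hle := hmin J hJ
  rw [(hp J).point_unique hy] at hle
  exact absurd hlt (not_lt.2 hle)

/-- The neighbours of a feasible basis `I` correspond to the elements of `I`, by the index that
leaves. -/
lemma feasibleBasisGraph_ncard_neighborSet (hrec : HasTrivialRecession A)
    (hnd : IsNondegenerate A c) (I : {I : Finset ι // ∃ x, IsFeasibleBasis A c I x}) :
    ((feasibleBasisGraph A c).neighborSet I).ncard = Fintype.card κ := by
  obtain ⟨x, hx⟩ := I.2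
  have hex : ∀ j ∈ I.1, ∃ J : {I : Finset ι // ∃ x, IsFeasibleBasis A c I x},
      (feasibleBasisGraph A c).Adj I J ∧ I.1.erase j ⊆ J.1 ∧ j ∉ J.1 := by
    intro j hj
    obtain ⟨d, hd0, hd1⟩ := hx.exists_edge hj
    obtain ⟨k, hk, t, -, hb⟩ := hx.pivot hrec hnd hj hd0 hd1
    refine ⟨⟨_, _, hb⟩, (card_inter_insert_erase hj hk).trans hx.card_eq,
      Finset.subset_insert _ _, fun hm => ?_⟩
    rcases Finset.mem_insert.1 hm with rfl | hm
    · exact hk hj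
    · exact Finset.notMem_erase j I.1 hm
  choose f hf_adj hf_sub hf_not using hex
  rw [← hx.card_eq, ← Set.ncard_coe_finset I.1]
  refine (Set.ncard_congr (fun j hj => f j hj) (fun j hj => hf_adj j hj) ?_ ?_).symm
  · intro i j hi hj hij
    by_contra hne
    have hmem : i ∈ (f j hj).1 := hf_sub j hj (Finset.mem_erase.2 ⟨hne, hi⟩)
    exact hf_not i hi (hij ▸ hmem)
  · intro J hJ
    have hadj : (I.1 ∩ J.1).card + 1 = Fintype.card κ := hJ
    obtain ⟨y, hy⟩ := J.2
    have hcard : (I.1 \ J.1).card = 1 := by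
      have := Finset.card_sdiff_add_card_inter I.1 J.1
      have := hx.card_eq
      omega
    obtain ⟨j, hj⟩ := Finset.card_eq_one.1 hcard
    have hjm : j ∈ I.1 \ J.1 := by simp [hj]
    obtain ⟨hjI, hjJ⟩ := Finset.mem_sdiff.1 hjm
    have hsub : I.1.erase j ⊆ J.1 := by
      intro i hi
      by_contra hiJ
      have him : i ∈ I.1 \ J.1 := Finset.mem_sdiff.2 ⟨Finset.mem_of_mem_erase hi, hiJ⟩
      rw [hj, Finset.mem_singleton] at him
      exact Finset.ne_of_mem_erase hi him
    obtain ⟨z, hz⟩ := (f j hjI).2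
    exact ⟨j, hjI, Subtype.ext
      (hx.eq_of_erase_subset hz hy hjI (hf_sub j hjI) (hf_not j hjI) hsub hjJ)⟩

end Simplex

/-! ### Specialization of the formal perturbation -/

/-- The vector `(1, ε, ε², …)` of powers of `ε`. -/
def powVec {q : ℕ} (ε : ℝ) : Fin q → ℝ := fun k => ε ^ (k : ℕ)

/-- The lexicographic order on coefficient vectors is the order of the polynomials near `0⁺`. -/
lemma eventually_lex_lt_dotProduct {q : ℕ} (v w : Fin q → ℝ) :
    ∀ᶠ ε in 𝓝[>] (0 : ℝ), toLex v < toLex w → v ⬝ᵥ powVec ε < w ⬝ᵥ powVec ε := by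
  by_cases hlt : toLex v < toLex w
  swap
  · exact Eventually.of_forall fun _ h => absurd h hlt
  obtain ⟨k, hk, hvw⟩ := hlt
  change ∀ j < k, v j = w j at hk
  change v k < w k at hvw
  -- The quotient of the difference by `ε ^ k` is continuous, with value `w k - v k` at `0`.
  let g : ℝ → ℝ := fun ε => ∑ j : Fin q, (w j - v j) * ε ^ ((j : ℕ) - (k : ℕ))
  have hg : Continuous g := by fun_prop
  have hg0 : g 0 = w k - v k := by
    refine (Finset.sum_eq_single k (fun j _ hjk => ?_) (by simp)).trans (by simp)
    rcases lt_or_gt_of_ne hjk with hj | hj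
    · rw [hk j hj, sub_self, zero_mul]
    · rw [zero_pow (Nat.sub_ne_zero_of_lt hj), mul_zero]
  have hpos : ∀ᶠ ε in 𝓝[>] (0 : ℝ), 0 < g ε :=
    (hg.continuousAt.eventually (lt_mem_nhds (by rw [hg0]; linarith))).filter_mono
      nhdsWithin_le_nhds
  filter_upwards [hpos, self_mem_nhdsWithin] with ε hε hε0 _
  have hfac : w ⬝ᵥ powVec ε - v ⬝ᵥ powVec ε = ε ^ (k : ℕ) * g ε := by
    simp only [dotProduct, powVec, g, Finset.mul_sum, ← Finset.sum_sub_distrib]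
    refine Finset.sum_congr rfl fun j _ => ?_
    rcases lt_or_ge j k with hj | hj
    · simp [hk j hj]
    · rw [mul_left_comm, ← pow_add, Nat.add_sub_cancel' hj]
      ring
  have := mul_pos (pow_pos (Set.mem_Ioi.1 hε0) (k : ℕ)) hε
  linarith

section LexBasis

variable {m n : ℕ} {A : Matrix (Fin m) (Fin n) ℝ} {b : Fin m → ℝ} {I : Finset (Fin m)}

lemma forall_mem_iff_forall_orderEmbOfFin (h : I.card = n) {p : Fin m → Prop} :
    (∀ i ∈ I, p i) ↔ ∀ r, p (I.orderEmbOfFin h r) := by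
  refine ⟨fun hp r => hp _ (Finset.orderEmbOfFin_mem I h r), fun hp i hi => ?_⟩
  have : i ∈ Set.range (I.orderEmbOfFin h) := by simpa using hi
  obtain ⟨r, rfl⟩ := this
  exact hp r

lemma isUnit_det_rowsOf_iff (h : I.card = n) :
    IsUnit (rowsOf A I h).det ↔ RowsSeparate A I := by
  rw [← Matrix.isUnit_iff_isUnit_det, ← Matrix.mulVec_injective_iff_isUnit]
  have hval : ∀ v r, (rowsOf A I h *ᵥ v) r = (A *ᵥ v) (I.orderEmbOfFin h r) := fun _ _ => rfl
  constructor
  · intro hinj v hv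
    refine hinj ?_
    ext r
    rw [hval, hval, Matrix.mulVec_zero, (forall_mem_iff_forall_orderEmbOfFin h).1 hv r]
    rfl
  · intro hs v w hvw
    refine hs.eq ((forall_mem_iff_forall_orderEmbOfFin h).2 fun r => ?_)
    rw [← hval, ← hval, hvw]

lemma rowsOf_mul_lexBasicPoint (h : I.card = n) (hdet : IsUnit (rowsOf A I h).det) :
    rowsOf A I h * lexBasicPoint A b I h = rowsOf (bPert b) I h :=
  Matrix.mul_nonsing_inv_cancel_left _ _ hdet

lemma mul_lexBasicPoint_row (h : I.card = n) (hdet : IsUnit (rowsOf A I h).det) :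
    ∀ i ∈ I, (A * lexBasicPoint A b I h) i = bPert b i :=
  (forall_mem_iff_forall_orderEmbOfFin h).2 fun r =>
    congrFun (rowsOf_mul_lexBasicPoint (b := b) h hdet) r

lemma bPert_succ (b : Fin m → ℝ) (i j : Fin m) :
    bPert b i j.succ = -(1 : Matrix (Fin m) (Fin m) ℝ) i j := rfl

/-- For `i ∉ I` the column `i.succ` of `b̃` vanishes in the rows with index in `I`, hence also in
`X^I`, but not in row `i`. -/
lemma mul_lexBasicPoint_row_ne (h : I.card = n) {i : Fin m} (hi : i ∉ I) :
    (A * lexBasicPoint A b I h) i ≠ bPert b i := by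
  intro heq
  have hcol : ∀ r, rowsOf (bPert b) I h r i.succ = 0 := by
    intro r
    have hne : I.orderEmbOfFin h r ≠ i := fun he => hi (he ▸ Finset.orderEmbOfFin_mem I h r)
    change bPert b (I.orderEmbOfFin h r) i.succ = 0
    rw [bPert_succ, Matrix.one_apply_ne hne, neg_zero]
  have hX : ∀ r, lexBasicPoint A b I h r i.succ = 0 := fun r => by
    rw [lexBasicPoint, Matrix.mul_apply]
    exact Finset.sum_eq_zero fun s _ => by rw [hcol, mul_zero]
  have h0 : (A * lexBasicPoint A b I h) i i.succ = 0 := by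
    rw [Matrix.mul_apply]
    exact Finset.sum_eq_zero fun s _ => by rw [hX, mul_zero]
  rw [heq, bPert_succ, Matrix.one_apply_eq] at h0
  norm_num at h0

/-- A positive `ε` at which the strict lexicographic comparisons between `A X^I` and `b̃`, for all
`n`-element sets `I`, are those of the specialized values. -/
structure IsSmall (A : Matrix (Fin m) (Fin n) ℝ) (b : Fin m → ℝ) (ε : ℝ) : Prop where
  pos : 0 < ε
  lt_of_lex_lt : ∀ (I : Finset (Fin m)) (h : I.card = n) (i : Fin m),
    toLex (bPert b i) < toLex ((A * lexBasicPoint A b I h) i) →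
      (bPert b *ᵥ powVec ε) i < ((A * lexBasicPoint A b I h) *ᵥ powVec ε) i
  gt_of_lex_gt : ∀ (I : Finset (Fin m)) (h : I.card = n) (i : Fin m),
    toLex ((A * lexBasicPoint A b I h) i) < toLex (bPert b i) →
      ((A * lexBasicPoint A b I h) *ᵥ powVec ε) i < (bPert b *ᵥ powVec ε) i

lemma exists_isSmall (A : Matrix (Fin m) (Fin n) ℝ) (b : Fin m → ℝ) : ∃ ε, IsSmall A b ε := by
  have h₁ : ∀ᶠ ε in 𝓝[>] (0 : ℝ), ∀ (I : Finset (Fin m)) (h : I.card = n) (i : Fin m),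
      toLex (bPert b i) < toLex ((A * lexBasicPoint A b I h) i) →
        (bPert b *ᵥ powVec ε) i < ((A * lexBasicPoint A b I h) *ᵥ powVec ε) i := by
    refine eventually_all.2 fun I => eventually_all.2 fun h => eventually_all.2 fun i => ?_
    exact eventually_lex_lt_dotProduct _ _
  have h₂ : ∀ᶠ ε in 𝓝[>] (0 : ℝ), ∀ (I : Finset (Fin m)) (h : I.card = n) (i : Fin m),
      toLex ((A * lexBasicPoint A b I h) i) < toLex (bPert b i) →
        ((A * lexBasicPoint A b I h) *ᵥ powVec ε) i < (bPert b *ᵥ powVec ε) i := by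
    refine eventually_all.2 fun I => eventually_all.2 fun h => eventually_all.2 fun i => ?_
    exact eventually_lex_lt_dotProduct _ _
  obtain ⟨ε, ⟨h, h'⟩, hε⟩ := ((h₁.and h₂).and self_mem_nhdsWithin).exists
  exact ⟨ε, hε, h, h'⟩

lemma bPert_mulVec_powVec (b : Fin m → ℝ) (ε : ℝ) (i : Fin m) :
    (bPert b *ᵥ powVec ε) i = b i - ε ^ ((i : ℕ) + 1) := by
  have h0 : bPert b i 0 = b i := rfl
  simp [Matrix.mulVec, dotProduct, Fin.sum_univ_succ, bPert_succ, h0, powVec, Matrix.one_apply,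
    sub_eq_add_neg]

/-- The basic point of the specialized system is the specialization of `X^I`. -/
lemma eq_lexBasicPoint_mulVec (h : I.card = n) (hs : RowsSeparate A I) {ε : ℝ} {x : Fin n → ℝ}
    (hx : ∀ i ∈ I, (A *ᵥ x) i = (bPert b *ᵥ powVec ε) i) :
    x = lexBasicPoint A b I h *ᵥ powVec ε := by
  refine hs.eq fun i hi => ?_
  rw [hx i hi, Matrix.mulVec_mulVec]
  exact congrArg (· ⬝ᵥ powVec ε)
    (mul_lexBasicPoint_row h ((isUnit_det_rowsOf_iff h).2 hs) i hi).symm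

lemma IsSmall.isNondegenerate {ε : ℝ} (hε : IsSmall A b ε) :
    IsNondegenerate A (bPert b *ᵥ powVec ε) := by
  intro I x hcard hs hx i hi
  have h : I.card = n := by simpa using hcard
  rw [eq_lexBasicPoint_mulVec h hs hx, Matrix.mulVec_mulVec]
  rcases lt_or_gt_of_ne (fun he => mul_lexBasicPoint_row_ne (A := A) (b := b) h hi
    (toLex.injective he)) with hlt | hlt
  · exact (hε.gt_of_lex_gt I h i hlt).ne
  · exact (hε.lt_of_lex_lt I h i hlt).ne'

lemma isLexFeasibleBasis_iff {ε : ℝ} (hε : IsSmall A b ε) :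
    IsLexFeasibleBasis A b I ↔ ∃ x, IsFeasibleBasis A (bPert b *ᵥ powVec ε) I x := by
  constructor
  · rintro ⟨h, hdet, hle⟩
    refine ⟨lexBasicPoint A b I h *ᵥ powVec ε, by simpa using h,
      (isUnit_det_rowsOf_iff h).1 hdet, fun i hi => ?_, fun i hi => ?_⟩
    · rw [Matrix.mulVec_mulVec]
      exact congrArg (· ⬝ᵥ powVec ε) (mul_lexBasicPoint_row h hdet i hi)
    · rw [Matrix.mulVec_mulVec]
      exact hε.lt_of_lex_lt I h i ((hle i).lt_of_ne fun he =>
        mul_lexBasicPoint_row_ne h hi (toLex.injective he).symm)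
  · rintro ⟨x, hx⟩
    have h : I.card = n := by simpa using hx.card_eq
    refine ⟨h, (isUnit_det_rowsOf_iff h).2 hx.separate, fun i => ?_⟩
    by_contra hlt
    have hgt := hε.gt_of_lex_gt I h i (not_le.1 hlt)
    rw [← Matrix.mulVec_mulVec, ← eq_lexBasicPoint_mulVec h hx.separate hx.tight] at hgt
    exact absurd hgt (not_lt.2 (hx.feasible i))

/-- The first column of `X^I` is a point of the unperturbed polyhedron. -/
lemma IsLexFeasibleBasis.polyhedron_nonempty (hI : IsLexFeasibleBasis A b I) :
    (polyhedron A b).Nonempty := by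
  obtain ⟨h, -, hle⟩ := hI
  refine ⟨fun r => lexBasicPoint A b I h r 0, fun i => ?_⟩
  exact Pi.apply_le_of_toLex (i := (0 : Fin (m + 1))) (hle i) fun j hj =>
    absurd hj (Fin.not_lt_zero j)

lemma hasTrivialRecession_of_isPolytope (hP : IsPolytope (polyhedron A b))
    (hne : (polyhedron A b).Nonempty) : HasTrivialRecession A := by
  intro v hv
  obtain ⟨V, hV⟩ := hP
  have hbdd : Bornology.IsBounded (polyhedron A b) := by
    rw [hV]
    exact isBounded_convexHull.2 V.finite_toSet.isBounded
  obtain ⟨x, hx⟩ := hne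
  obtain ⟨R, hR⟩ := hbdd.exists_norm_le
  by_contra hv0
  have hvpos : 0 < ‖v‖ := norm_pos_iff.2 hv0
  have hxR := hR x hx
  have hR0 : 0 ≤ R := (norm_nonneg x).trans hxR
  -- A step of length `2 R + 1` from `x` leaves the ball of radius `R`.
  let t : ℝ := (2 * R + 1) / ‖v‖
  have ht : 0 ≤ t := by positivity
  have hmem : x + t • v ∈ polyhedron A b := fun i => by
    rw [mulVec_add_smul_apply]
    exact (hx i).trans (le_add_of_nonneg_right (mul_nonneg ht (hv i)))
  have htv : ‖t • v‖ = 2 * R + 1 := by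
    rw [norm_smul, Real.norm_of_nonneg ht, div_mul_cancel₀ _ hvpos.ne']
  have htri : ‖t • v‖ ≤ ‖x + t • v‖ + ‖x‖ := by
    simpa using norm_sub_le (x + t • v) x
  linarith [hR _ hmem]

/-- For small `ε` the lex graph is the graph of feasible bases of the specialized system. -/
def lexGraphIso {ε : ℝ} (hε : IsSmall A b ε) :
    lexGraph A b ≃g feasibleBasisGraph A (bPert b *ᵥ powVec ε) where
  toEquiv := Equiv.subtypeEquivRight fun _ => isLexFeasibleBasis_iff hε
  map_rel_iff' := by
    intro I J
    simp [lexGraph, feasibleBasisGraph]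

end LexBasis

theorem mainTheorem5 {m n : ℕ} (A : Matrix (Fin m) (Fin n) ℝ) (b : Fin m → ℝ)
    (hP : IsPolytope (polyhedron A b)) :
    ((lexGraph A b).Preconnected ∧
      ((polyhedron A b).Nonempty → (lexGraph A b).Connected)) ∧
    (∀ I : {I : Finset (Fin m) // IsLexFeasibleBasis A b I},
      ((lexGraph A b).neighborSet I).ncard = n) := by
  obtain ⟨ε, hε⟩ := exists_isSmall A b
  have hpre : (lexGraph A b).Preconnected := by
    intro I J
    have hrec := hasTrivialRecession_of_isPolytope hP I.2.polyhedron_nonempty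
    exact (lexGraphIso hε).reachable_iff.1
      (feasibleBasisGraph_preconnected hrec hε.isNondegenerate _ _)
  refine ⟨⟨hpre, fun hne => ?_⟩, fun I => ?_⟩
  · obtain ⟨x, hx⟩ := id hne
    have hfeas : ∀ i, (bPert b *ᵥ powVec ε) i ≤ (A *ᵥ x) i := fun i => by
      rw [bPert_mulVec_powVec]
      exact (sub_le_self _ (pow_pos hε.pos _).le).trans (hx i)
    obtain ⟨I, hI⟩ := exists_isFeasibleBasis (hasTrivialRecession_of_isPolytope hP hne)
      hε.isNondegenerate hfeas
    have : Nonempty {I : Finset (Fin m) // IsLexFeasibleBasis A b I} :=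
      ⟨⟨I, (isLexFeasibleBasis_iff hε).2 hI⟩⟩
    exact ⟨hpre⟩
  · have hrec := hasTrivialRecession_of_isPolytope hP I.2.polyhedron_nonempty
    rw [← Nat.card_coe_set_eq, Nat.card_congr ((lexGraphIso hε).mapNeighborSet I),
      Nat.card_coe_set_eq, feasibleBasisGraph_ncard_neighborSet hrec hε.isNondegenerate,
      Fintype.card_fin]
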